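/- Let $\mathcal K^2$ be the set of convex bodies (nonempty compact convex sets) in $\mathbb R^2$. For $K,C\in\mathcal K^2$ with $C$ full-dimensional (i.e. with nonempty interior), let $R(K,C)$ be the smallest $\lambda\ge 0$ such that a translate of $K$ is contained in $\lambda C$, let $r(K,C)$ be the largest $\lambda\ge 0$ such that a translate of $K$ contains $\lambda C$, and let $D(K,C)=2\max_{x,y\in K}R(\{x,y\},C)$. If $K$ is not a single point, put $$f(K,C)=\left(\frac{r(K,C)}{R(K,C)},\frac{D(K,C)}{2R(K,C)}\right)\in[0,1]^2,$$ and let $f(\mathcal K^2,\mathcal K^2)$ be the set of all points $f(K,C)$, where $K\in\mathcal K^2$ is not a single point and $C\in\mathcal K^2$ is full-dimensional. **Theorem.** For all $K,C\in\mathcal K^2$ with $C$ full-dimensional, $$D(K,C)\le 2R(K,C),\qquad 4r(K,C)+2R(K,C)\le 3D(K,C),\qquad D(K,C)\bigl(2R(K,C)-D(K,C)\bigr)\le 4\,r(K,C)\,R(K,C).$$ Moreover, these three inequalities completely describe $f(\mathcal K^2,\mathcal K^2)$ and its boundary: $$f(\mathcal K^2,\mathcal K^2)=\left\{(x,y)\in[0,1]^2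 : y\le 1,\ 2x+1\le 3y,\ y(1-y)\le x\right\},$$ and the topological boundary of $f(\mathcal K^2,\mathcal K^2)$ consists of exactly those points of this set at which at least one of the three inequalities $y\le 1$, $2x+1\le 3y$, $y(1-y)\le x$ holds with equality. -/

import Mathlib

open scoped Pointwise

noncomputable section

namespace RadiiDiagram

/-- The plane. -/
abbrev Plane : Type := EuclideanSpace ℝ (Fin 2)

/-- The circumradius `R(K, C)`: the smallest `l ≥ 0` such that a translate of `K` is contained
in `l C`. -/
def circumradius (K C : Set Plane) : ℝ :=
  sInf {l : ℝ | 0 ≤ l ∧ ∃ t : Plane, t +ᵥ K ⊆ l • C}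

/-- The inradius `r(K, C)`: the largest `l ≥ 0` such that a translate of `K` contains `l C`. -/
def inradius (K C : Set Plane) : ℝ :=
  sSup {l : ℝ | 0 ≤ l ∧ ∃ t : Plane, l • C ⊆ t +ᵥ K}

/-- The diameter `D(K, C)`: twice the maximal circumradius `R({x, y}, C)` with `x, y ∈ K`. -/
def diameter (K C : Set Plane) : ℝ :=
  2 * sSup {d : ℝ | ∃ x ∈ K, ∃ y ∈ K, d = circumradius {x, y} C}

/-- The map `f(K, C) = (r(K, C) / R(K, C), D(K, C) / (2 R(K, C)))`. -/
def radiiPoint (K C : Set Plane) : ℝ × ℝ :=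
  (inradius K C / circumradius K C, diameter K C / (2 * circumradius K C))

/-- The union `f(𝒦², 𝒦²)` of the `(r, D, R)`-diagrams over all planar gauges. The gauge `C` is
full-dimensional, and `K` is not a single point (that is, `R(K, C) ≠ 0`), so that `f(K, C)` is
defined. -/
def unionDiagram : Set (ℝ × ℝ) :=
  {p | ∃ K C : ConvexBody Plane, (K : Set Plane).Nontrivial ∧ (interior (C : Set Plane)).Nonempty ∧
    p = radiiPoint K C}

end RadiiDiagram

end

namespace RadiiDiagram

/-! Write `d = D/2`. The bound `d ≤ R` is monotonicity of the circumradius. The other two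
inequalities come from one certificate. If `l < R`, Helly's theorem gives three points `x i` of `K`
that no translate of `l C` contains. Separation then gives functionals `u i` with sum zero such
that, with `h i` the maximum of `u i` on `C`, `H = ∑ h i` and `L = ∑ u i (x i)`, one has `l H < L`
(`exists_circumscribed_triangle`). So `C` lies in the triangle `{u i ≤ h i}`, its width along each
`u i` is at most `H`, and that of `K` is at most `d H`.

If a translate of `m C` lies in `K`, comparing `x i` with the point of that copy minimal for `u i`
and summing gives `L ≤ (3 d - 2 m) H`, hence `R + 2 r ≤ 3 d`. For the last inequality, the triangle
`x₁ x₂ x₃` contains an inscribed homothetic copy of the circumscribed triangle, and hence of `C`,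
whose ratio is bounded below by the width bounds (`exists_homothety`, `mul_add_mul_sub_ge`).

Conversely, a triangular gauge with a two-parameter family of truncated triangles attains every
point: the region is the union of the segments from `(1, 1)` to the arc `x = y (1 - y)`, `1/2 ≤ y ≤
1`, with one parameter choosing the segment and the other the position on it. -/

/-! ### Elementary properties of the three radii -/

theorem vadd_subset_smul_iff {K C : Set Plane} {t : Plane} {l : ℝ} :
    t +ᵥ K ⊆ l • C ↔ ∀ x ∈ K, ∃ c ∈ C, l • c = t + x := by
  constructor
  · intro h x hx
    exact h ⟨x, hx, rfl⟩
  · rintro h _ ⟨x, hx, rfl⟩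
    exact h x hx

theorem smul_subset_vadd_iff {K C : Set Plane} {t : Plane} {l : ℝ} :
    l • C ⊆ t +ᵥ K ↔ ∀ c ∈ C, ∃ x ∈ K, t + x = l • c := by
  constructor
  · intro h c hc
    exact h ⟨c, hc, rfl⟩
  · rintro h _ ⟨c, hc, rfl⟩
    exact h c hc

/-- If a translate of `K` lies in `l C`, then a translate of `K` lies in `m C` for all `m ≥ l`. -/
theorem exists_translate_of_le {K : Set Plane} {C : ConvexBody Plane} {l m : ℝ} (hl : 0 ≤ l)
    (hlm : l ≤ m) (h : ∃ t : Plane, t +ᵥ K ⊆ l • (C : Set Plane)) :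
    ∃ t : Plane, t +ᵥ K ⊆ m • (C : Set Plane) := by
  obtain ⟨t, ht⟩ := h
  obtain ⟨c₀, hc₀⟩ := C.nonempty
  refine ⟨t + (m - l) • c₀, vadd_subset_smul_iff.2 fun x hx => ?_⟩
  obtain ⟨c, hc, hcx⟩ := vadd_subset_smul_iff.1 ht x hx
  have hadd := (C.convex.add_smul hl (sub_nonneg.2 hlm)).symm.subset
    (Set.add_mem_add (Set.smul_mem_smul_set hc) (Set.smul_mem_smul_set hc₀))
  rw [add_sub_cancel] at hadd
  obtain ⟨c', hc', he⟩ := hadd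
  refine ⟨c', hc', ?_⟩
  simp only at he
  rw [he, hcx]
  abel

theorem circumradius_nonneg (K C : Set Plane) : 0 ≤ circumradius K C :=
  Real.sInf_nonneg fun _ h => h.1

theorem inradius_nonneg (K C : Set Plane) : 0 ≤ inradius K C :=
  Real.sSup_nonneg fun _ h => h.1

theorem diameter_nonneg (K C : Set Plane) : 0 ≤ diameter K C := by
  refine mul_nonneg zero_le_two (Real.sSup_nonneg ?_)
  rintro _ ⟨x, -, y, -, rfl⟩
  exact circumradius_nonneg _ _

theorem circumradius_le {K C : Set Plane} {l : ℝ} (hl : 0 ≤ l)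
    (h : ∃ t : Plane, t +ᵥ K ⊆ l • C) : circumradius K C ≤ l :=
  csInf_le ⟨0, fun _ h => h.1⟩ ⟨hl, h⟩

theorem exists_translate_subset {K : Set Plane} (hK : Bornology.IsBounded K)
    {C : ConvexBody Plane} (hC : (interior (C : Set Plane)).Nonempty) :
    ∃ l : ℝ, 0 ≤ l ∧ ∃ t : Plane, t +ᵥ K ⊆ l • (C : Set Plane) := by
  obtain ⟨c, hc⟩ := hC
  obtain ⟨ε, hε, hball⟩ := Metric.mem_nhds_iff.1 (mem_interior_iff_mem_nhds.1 hc)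
  obtain ⟨M, hM, hKM⟩ := hK.exists_pos_norm_le
  have hl : 0 < 2 * M / ε := by positivity
  -- The factor 2 makes the rescaled points have norm at most `ε / 2`, strictly inside the open
  -- ball.
  refine ⟨2 * M / ε, hl.le, (2 * M / ε) • c, vadd_subset_smul_iff.2 fun x hx => ?_⟩
  refine ⟨c + (2 * M / ε)⁻¹ • x, hball ?_, ?_⟩
  · rw [mem_ball_iff_norm, add_sub_cancel_left, norm_smul, Real.norm_of_nonneg (by positivity)]
    have := hKM x hx
    rw [inv_div, div_mul_eq_mul_div, div_lt_iff₀ (by positivity)]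
    nlinarith
  · rw [smul_add, smul_inv_smul₀ hl.ne']

theorem exists_translate_of_circumradius_lt {K : Set Plane} (hK : Bornology.IsBounded K)
    {C : ConvexBody Plane} (hC : (interior (C : Set Plane)).Nonempty) {l : ℝ}
    (hl : circumradius K C < l) : ∃ t : Plane, t +ᵥ K ⊆ l • (C : Set Plane) := by
  obtain ⟨m, ⟨hm, ht⟩, hml⟩ := exists_lt_of_csInf_lt (exists_translate_subset hK hC) hl
  exact exists_translate_of_le hm hml.le ht

theorem circumradius_mono {K L : Set Plane} (hKL : K ⊆ L) (hL : Bornology.IsBounded L)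
    {C : ConvexBody Plane} (hC : (interior (C : Set Plane)).Nonempty) :
    circumradius K C ≤ circumradius L C := by
  refine le_csInf (exists_translate_subset hL hC) ?_
  rintro l ⟨hl, t, ht⟩
  exact circumradius_le hl ⟨t, (Set.vadd_set_mono hKL).trans ht⟩

theorem circumradius_pair_le_circumradius {K C : ConvexBody Plane}
    (hC : (interior (C : Set Plane)).Nonempty) {x y : Plane} (hx : x ∈ K) (hy : y ∈ K) :
    circumradius {x, y} C ≤ circumradius K C :=
  circumradius_mono (Set.insert_subset hx (Set.singleton_subset_iff.2 hy)) K.isBounded hC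

theorem diameter_le {K : ConvexBody Plane} {C : Set Plane} {d : ℝ}
    (h : ∀ x ∈ K, ∀ y ∈ K, circumradius {x, y} C ≤ d) : diameter K C ≤ 2 * d := by
  refine mul_le_mul_of_nonneg_left (csSup_le ?_ ?_) zero_le_two
  · obtain ⟨x, hx⟩ := K.nonempty
    exact ⟨_, x, hx, x, hx, rfl⟩
  · rintro _ ⟨x, hx, y, hy, rfl⟩
    exact h x hx y hy

theorem diameter_le_two_mul_circumradius {K C : ConvexBody Plane}
    (hC : (interior (C : Set Plane)).Nonempty) : diameter K C ≤ 2 * circumradius K C :=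
  diameter_le fun _ hx _ hy => circumradius_pair_le_circumradius hC hx hy

theorem circumradius_pair_le_diameter {K C : ConvexBody Plane}
    (hC : (interior (C : Set Plane)).Nonempty) {x y : Plane} (hx : x ∈ K) (hy : y ∈ K) :
    circumradius {x, y} C ≤ diameter K C / 2 := by
  rw [diameter, mul_div_cancel_left₀ _ two_ne_zero]
  refine le_csSup ⟨circumradius K C, ?_⟩ ⟨x, hx, y, hy, rfl⟩
  rintro _ ⟨x, hx, y, hy, rfl⟩
  exact circumradius_pair_le_circumradius hC hx hy

/-- The width of `K` in any direction is at most `D(K, C) / 2` times the width of `C`. -/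
theorem sub_le_diameter_mul_width {K C : ConvexBody Plane}
    (hC : (interior (C : Set Plane)).Nonempty) {x y : Plane} (hx : x ∈ K) (hy : y ∈ K)
    (u : Plane →L[ℝ] ℝ) {w : ℝ} (hw : ∀ c ∈ C, ∀ c' ∈ C, u c - u c' ≤ w) :
    u x - u y ≤ diameter K C / 2 * w := by
  have hw0 : 0 ≤ w := by
    obtain ⟨c, hc⟩ := C.nonempty
    simpa using hw c hc c hc
  -- The slack avoids proving that the infimum `R({x, y}, C)` is attained; dividing by `w + 1`
  -- covers `w = 0`.
  refine le_of_forall_pos_le_add fun ε hε => ?_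
  have hpos : 0 < ε / (w + 1) := by positivity
  obtain ⟨t, ht⟩ := exists_translate_of_circumradius_lt (K := {x, y}) (Set.toFinite _).isBounded hC
    (lt_of_le_of_lt (circumradius_pair_le_diameter hC hx hy) (lt_add_of_pos_right _ hpos))
  rw [vadd_subset_smul_iff] at ht
  obtain ⟨c, hc, hcx⟩ := ht x (by simp)
  obtain ⟨c', hc', hcy⟩ := ht y (by simp)
  have e1 := congrArg u hcx
  have e2 := congrArg u hcy
  simp only [map_smul, map_add, smul_eq_mul] at e1 e2
  have hD := diameter_nonneg K C
  have h1 : (diameter K C / 2 + ε / (w + 1)) * (u c - u c') ≤ (diameter K C / 2 + ε / (w + 1)) * w :=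
    mul_le_mul_of_nonneg_left (hw c hc c' hc') (by positivity)
  have h2 : ε / (w + 1) * w ≤ ε := by
    rw [div_mul_eq_mul_div, div_le_iff₀ (by positivity)]
    nlinarith
  linarith

theorem exists_lt_of_mem_interior {C : Set Plane} {u : Plane →L[ℝ] ℝ} (hu : u ≠ 0) {m : Plane}
    (hm : m ∈ interior C) : ∃ c ∈ C, u m < u c := by
  obtain ⟨v, hv⟩ : ∃ v, 0 < u v := by
    by_contra! h
    refine hu (ContinuousLinearMap.ext fun v => ?_)
    have h1 := h v
    have h2 := h (-v)
    rw [map_neg] at h2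
    simp only [zero_apply]
    linarith
  obtain ⟨ε, hε, hball⟩ := Metric.mem_nhds_iff.1 (mem_interior_iff_mem_nhds.1 hm)
  have hvn : 0 ≤ ‖v‖ := norm_nonneg v
  have hpos : 0 < ε / (‖v‖ + 1) := by positivity
  refine ⟨m + (ε / (‖v‖ + 1)) • v, hball ?_, ?_⟩
  · rw [mem_ball_iff_norm, add_sub_cancel_left, norm_smul, Real.norm_of_nonneg hpos.le,
      div_mul_eq_mul_div, div_lt_iff₀ (by positivity)]
    nlinarith
  · rw [map_add, map_smul, smul_eq_mul]
    nlinarith [mul_pos hpos hv]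

/-- Compare widths in a coordinate direction, where `C` has positive width because of its interior
point. Besides `r ≤ D / 2`, this supplies the upper bound that makes the supremum defining `r`
meaningful. -/
theorem le_diameter_of_smul_subset {K C : ConvexBody Plane}
    (hC : (interior (C : Set Plane)).Nonempty) {l : ℝ}
    (h : ∃ t : Plane, l • (C : Set Plane) ⊆ t +ᵥ (K : Set Plane)) : l ≤ diameter K C / 2 := by
  obtain ⟨t, ht⟩ := h
  rw [smul_subset_vadd_iff] at ht
  let u : Plane →L[ℝ] ℝ := EuclideanSpace.proj 0
  have hu : u ≠ 0 := by
    intro h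
    have := congrArg (fun f : Plane →L[ℝ] ℝ => f (EuclideanSpace.single 0 1)) h
    simp [u] at this
  obtain ⟨a, ha, hamax⟩ := C.isCompact.exists_isMaxOn C.nonempty u.continuous.continuousOn
  obtain ⟨b, hb, hbmin⟩ := C.isCompact.exists_isMinOn C.nonempty u.continuous.continuousOn
  have hab : 0 < u a - u b := by
    obtain ⟨m, hm⟩ := hC
    obtain ⟨c, hc, hmc⟩ := exists_lt_of_mem_interior hu hm
    have := hamax hc
    have := hbmin (interior_subset hm)
    simp only [Set.mem_ofPred_eq] at *
    linarith
  obtain ⟨x, hx, hxa⟩ := ht a ha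
  obtain ⟨y, hy, hyb⟩ := ht b hb
  have e1 := congrArg u hxa
  have e2 := congrArg u hyb
  simp only [map_smul, map_add, smul_eq_mul] at e1 e2
  have := sub_le_diameter_mul_width hC hx hy u (w := u a - u b) fun c hc c' hc' =>
    sub_le_sub (hamax hc) (hbmin hc')
  refine le_of_mul_le_mul_right ?_ hab
  linarith

theorem zero_smul_subset (K C : ConvexBody Plane) :
    ∃ t : Plane, (0 : ℝ) • (C : Set Plane) ⊆ t +ᵥ (K : Set Plane) := by
  obtain ⟨x, hx⟩ := K.nonempty
  exact ⟨-x, smul_subset_vadd_iff.2 fun c _ => ⟨x, hx, by simp⟩⟩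

theorem inradius_le {K C : ConvexBody Plane} {m : ℝ}
    (h : ∀ l, 0 ≤ l → (∃ t : Plane, l • (C : Set Plane) ⊆ t +ᵥ (K : Set Plane)) → l ≤ m) :
    inradius K C ≤ m :=
  csSup_le ⟨0, le_rfl, zero_smul_subset K C⟩ fun l hl => h l hl.1 hl.2

theorem le_inradius {K C : ConvexBody Plane} (hC : (interior (C : Set Plane)).Nonempty) {l : ℝ}
    (hl : 0 ≤ l) (h : ∃ t : Plane, l • (C : Set Plane) ⊆ t +ᵥ (K : Set Plane)) :
    l ≤ inradius K C :=
  le_csSup ⟨diameter K C / 2, fun _ h => le_diameter_of_smul_subset hC h.2⟩ ⟨hl, h⟩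

theorem inradius_le_diameter {K C : ConvexBody Plane}
    (hC : (interior (C : Set Plane)).Nonempty) : inradius K C ≤ diameter K C / 2 :=
  inradius_le fun _ _ h => le_diameter_of_smul_subset hC h

theorem circumradius_pos {K C : ConvexBody Plane} (hC : (interior (C : Set Plane)).Nonempty)
    (hK : (K : Set Plane).Nontrivial) : 0 < circumradius K C := by
  obtain ⟨x, hx, y, hy, hxy⟩ := hK
  obtain ⟨M, hM, hCM⟩ := C.isBounded.exists_pos_norm_le
  have hd : 0 < ‖x - y‖ := norm_pos_iff.2 (sub_ne_zero.2 hxy)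
  refine lt_of_lt_of_le (show 0 < ‖x - y‖ / (2 * M) by positivity)
    (le_csInf (exists_translate_subset K.isBounded hC) ?_)
  rintro l ⟨hl, t, ht⟩
  rw [vadd_subset_smul_iff] at ht
  obtain ⟨c, hc, hcx⟩ := ht x hx
  obtain ⟨c', hc', hcy⟩ := ht y hy
  have e : x - y = l • (c - c') := by
    rw [smul_sub, hcx, hcy]
    abel
  rw [div_le_iff₀ (by positivity), e, norm_smul, Real.norm_of_nonneg hl]
  refine mul_le_mul_of_nonneg_left ((norm_sub_le _ _).trans ?_) hl
  linarith [hCM c hc, hCM c' hc']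

/-! ### Certificates for the circumradius: Helly and separation -/

theorem exists_three_of_card_le_three {ι : Type*} [Nonempty ι] (I : Finset ι) (hI : I.card ≤ 3) :
    ∃ a b c : ι, ∀ i ∈ I, i = a ∨ i = b ∨ i = c := by
  classical
  obtain ⟨o⟩ := ‹Nonempty ι›
  obtain h | h | h | h : I.card = 0 ∨ I.card = 1 ∨ I.card = 2 ∨ I.card = 3 := by omega
  · exact ⟨o, o, o, by simp [Finset.card_eq_zero.1 h]⟩
  · obtain ⟨a, rfl⟩ := Finset.card_eq_one.1 h
    exact ⟨a, a, a, by simp⟩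
  · obtain ⟨a, b, -, rfl⟩ := Finset.card_eq_two.1 h
    exact ⟨a, b, b, by simp⟩
  · obtain ⟨a, b, c, -, -, -, rfl⟩ := Finset.card_eq_three.1 h
    exact ⟨a, b, c, by simp⟩

/-- If no translate of `K` lies in `l C`, then this already holds for some three points of `K`. -/
theorem exists_three_points_of_not_translate {K C : ConvexBody Plane} {l : ℝ}
    (h : ¬∃ t : Plane, t +ᵥ (K : Set Plane) ⊆ l • (C : Set Plane)) :
    ∃ x₁ ∈ K, ∃ x₂ ∈ K, ∃ x₃ ∈ K,
      ¬∃ t : Plane, t + x₁ ∈ l • (C : Set Plane) ∧ t + x₂ ∈ l • (C : Set Plane) ∧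
        t + x₃ ∈ l • (C : Set Plane) := by
  by_contra! hcon
  refine h ?_
  have hne : Nonempty (K : Set Plane) := K.nonempty.to_subtype
  -- Helly is applied to the sets `l C - x` of translation vectors that bring `x` into `l C`.
  have key : (⋂ x : (K : Set Plane), (-(x : Plane)) +ᵥ (l • (C : Set Plane))).Nonempty := by
    refine Convex.helly_theorem_compact' (𝕜 := ℝ) (fun x => (C.convex.smul l).vadd _)
      (fun x => (C.isCompact.smul l).vadd _) fun I hI => ?_
    rw [finrank_euclideanSpace_fin] at hI
    obtain ⟨a, b, c, habc⟩ := exists_three_of_card_le_three I hI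
    obtain ⟨t, ha, hb, hc⟩ := hcon a a.2 b b.2 c c.2
    refine ⟨t, Set.mem_iInter₂.2 fun i hi => ?_⟩
    rw [Set.mem_vadd_set_iff_neg_vadd_mem, neg_neg, vadd_eq_add, add_comm]
    rcases habc i hi with rfl | rfl | rfl <;> assumption
  obtain ⟨t, ht⟩ := key
  refine ⟨t, ?_⟩
  rintro _ ⟨x, hx, rfl⟩
  have := Set.mem_iInter.1 ht ⟨x, hx⟩
  rw [Set.mem_vadd_set_iff_neg_vadd_mem, neg_neg, vadd_eq_add, add_comm] at this
  exact this

/-- A certificate for the fact that no translate of `K` lies in `l C`: three points of `K`, and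
three functionals with sum zero. -/
theorem exists_functionals_of_not_translate {K C : ConvexBody Plane} {l : ℝ}
    (h : ¬∃ t : Plane, t +ᵥ (K : Set Plane) ⊆ l • (C : Set Plane)) :
    ∃ x₁ ∈ K, ∃ x₂ ∈ K, ∃ x₃ ∈ K, ∃ u₁ u₂ u₃ : Plane →L[ℝ] ℝ, u₁ + u₂ + u₃ = 0 ∧
      ∀ c₁ ∈ C, ∀ c₂ ∈ C, ∀ c₃ ∈ C,
        l * (u₁ c₁ + u₂ c₂ + u₃ c₃) < u₁ x₁ + u₂ x₂ + u₃ x₃ := by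
  obtain ⟨x₁, h₁, x₂, h₂, x₃, h₃, hx⟩ := exists_three_points_of_not_translate h
  refine ⟨x₁, h₁, x₂, h₂, x₃, h₃, ?_⟩
  -- Differences eliminate the translation: the three points fit into a translate of `l C` exactly
  -- when `(x₁ - x₃, x₂ - x₃)` lies in the compact convex set `φ (C × C × C)`.
  let φ : Plane × Plane × Plane →L[ℝ] Plane × Plane :=
    (l • (ContinuousLinearMap.fst ℝ Plane (Plane × Plane) -
      (ContinuousLinearMap.snd ℝ Plane Plane).comp
        (ContinuousLinearMap.snd ℝ Plane (Plane × Plane)))).prod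
    (l • ((ContinuousLinearMap.fst ℝ Plane Plane).comp
        (ContinuousLinearMap.snd ℝ Plane (Plane × Plane)) -
      (ContinuousLinearMap.snd ℝ Plane Plane).comp
        (ContinuousLinearMap.snd ℝ Plane (Plane × Plane))))
  have hφ : ∀ c₁ c₂ c₃, φ (c₁, c₂, c₃) = (l • (c₁ - c₃), l • (c₂ - c₃)) := fun _ _ _ => rfl
  let S : Set (Plane × Plane × Plane) := (C : Set Plane) ×ˢ (C : Set Plane) ×ˢ (C : Set Plane)
  have hconv : Convex ℝ (φ '' S) :=
    (C.convex.prod (C.convex.prod C.convex)).linear_image φ.toLinearMap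
  have hclosed : IsClosed (φ '' S) :=
    ((C.isCompact.prod (C.isCompact.prod C.isCompact)).image φ.continuous).isClosed
  have hnot : (x₁ - x₃, x₂ - x₃) ∉ φ '' S := by
    rintro ⟨⟨c₁, c₂, c₃⟩, ⟨hc₁, hc₂, hc₃⟩, he⟩
    rw [hφ, Prod.mk.injEq, smul_sub, smul_sub] at he
    refine hx ⟨l • c₃ - x₃, ⟨c₁, hc₁, ?_⟩, ⟨c₂, hc₂, ?_⟩, ⟨c₃, hc₃, ?_⟩⟩
    · simp only
      rw [sub_add, ← neg_sub x₁ x₃, ← he.1]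
      abel
    · simp only
      rw [sub_add, ← neg_sub x₂ x₃, ← he.2]
      abel
    · simp
  obtain ⟨f, a, hfa, hax⟩ := geometric_hahn_banach_closed_point hconv hclosed hnot
  let f₁ : Plane →L[ℝ] ℝ := f.comp (ContinuousLinearMap.inl ℝ Plane Plane)
  let f₂ : Plane →L[ℝ] ℝ := f.comp (ContinuousLinearMap.inr ℝ Plane Plane)
  have hf : ∀ v w, f (v, w) = f₁ v + f₂ w := by
    intro v w
    simp only [f₁, f₂, ContinuousLinearMap.comp_apply, ContinuousLinearMap.inl_apply,
      ContinuousLinearMap.inr_apply, ← map_add, Prod.mk_add_mk, add_zero, zero_add]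
  refine ⟨f₁, f₂, -f₁ - f₂, by abel, fun c₁ hc₁ c₂ hc₂ c₃ hc₃ => ?_⟩
  have h1 := (hfa _ ⟨(c₁, c₂, c₃), ⟨hc₁, hc₂, hc₃⟩, rfl⟩).trans hax
  rw [hφ, hf, hf] at h1
  simp only [map_smul, map_sub, smul_eq_mul, sub_apply, neg_apply] at h1 ⊢
  linarith

/-- The data of a triangle `{u i ≤ h i}` around `C`, and of three points of `K` that show that no
translate of `K` lies in `l` times the triangle. -/
theorem exists_circumscribed_triangle {K C : ConvexBody Plane}
    (hC : (interior (C : Set Plane)).Nonempty) {l : ℝ} (hl : 0 ≤ l) (hlR : l < circumradius K C) :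
    ∃ x₁ ∈ K, ∃ x₂ ∈ K, ∃ x₃ ∈ K, ∃ (u₁ u₂ u₃ : Plane →L[ℝ] ℝ) (h₁ h₂ h₃ : ℝ),
      (∀ v, u₁ v + u₂ v + u₃ v = 0) ∧
      (∀ c ∈ C, u₁ c ≤ h₁) ∧ (∀ c ∈ C, u₂ c ≤ h₂) ∧ (∀ c ∈ C, u₃ c ≤ h₃) ∧
      0 < h₁ + h₂ + h₃ ∧ l * (h₁ + h₂ + h₃) < u₁ x₁ + u₂ x₂ + u₃ x₃ := by
  obtain ⟨x₁, hx₁, x₂, hx₂, x₃, hx₃, u₁, u₂, u₃, hu, hlt⟩ :=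
    exists_functionals_of_not_translate fun ht => hlR.not_ge (circumradius_le hl ht)
  have hu' : ∀ v, u₁ v + u₂ v + u₃ v = 0 := fun v => by
    simpa using congrArg (fun f : Plane →L[ℝ] ℝ => f v) hu
  obtain ⟨a₁, ha₁, hm₁⟩ := C.isCompact.exists_isMaxOn C.nonempty u₁.continuous.continuousOn
  obtain ⟨a₂, ha₂, hm₂⟩ := C.isCompact.exists_isMaxOn C.nonempty u₂.continuous.continuousOn
  obtain ⟨a₃, ha₃, hm₃⟩ := C.isCompact.exists_isMaxOn C.nonempty u₃.continuous.continuousOn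
  have hle₁ : ∀ c ∈ C, u₁ c ≤ u₁ a₁ := fun c hc => hm₁ hc
  have hle₂ : ∀ c ∈ C, u₂ c ≤ u₂ a₂ := fun c hc => hm₂ hc
  have hle₃ : ∀ c ∈ C, u₃ c ≤ u₃ a₃ := fun c hc => hm₃ hc
  refine ⟨x₁, hx₁, x₂, hx₂, x₃, hx₃, u₁, u₂, u₃, u₁ a₁, u₂ a₂, u₃ a₃, hu', hle₁, hle₂, hle₃, ?_,
    hlt a₁ ha₁ a₂ ha₂ a₃ ha₃⟩
  -- The `u i` sum to zero at an interior point `m` and each `h i` is at least `u i m`, strictly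
  -- when `u i ≠ 0`. All three vanishing would contradict the strict separation.
  obtain ⟨m, hm⟩ := hC
  have hmC : m ∈ C := interior_subset hm
  have hsum := hu' m
  have := hle₁ m hmC
  have := hle₂ m hmC
  have := hle₃ m hmC
  by_cases h1 : u₁ = 0
  · by_cases h2 : u₂ = 0
    · have h3 : u₃ = 0 := by simpa [h1, h2] using hu
      simpa [h1, h2, h3] using hlt m hmC m hmC m hmC
    · obtain ⟨c, hc, hlt⟩ := exists_lt_of_mem_interior h2 hm
      have := hle₂ c hc
      linarith
  · obtain ⟨c, hc, hlt⟩ := exists_lt_of_mem_interior h1 hm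
    have := hle₁ c hc
    linarith

/-! ### The inequality `4 r + 2 R ≤ 3 D` -/

theorem circumradius_add_two_mul_le {K C : ConvexBody Plane}
    (hC : (interior (C : Set Plane)).Nonempty) {l m : ℝ} (hl : 0 ≤ l) (hlR : l < circumradius K C)
    (hm : ∃ t : Plane, m • (C : Set Plane) ⊆ t +ᵥ (K : Set Plane)) :
    l + 2 * m ≤ 3 * (diameter K C / 2) := by
  have hmd := le_diameter_of_smul_subset hC hm
  obtain ⟨x₁, hx₁, x₂, hx₂, x₃, hx₃, u₁, u₂, u₃, h₁, h₂, h₃, hu, hle₁, hle₂, hle₃, hH, hlt⟩ :=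
    exists_circumscribed_triangle hC hl hlR
  obtain ⟨t, ht⟩ := hm
  rw [smul_subset_vadd_iff] at ht
  have width : ∀ (u : Plane →L[ℝ] ℝ) (h : ℝ), (∀ c ∈ C, u c ≤ h) → ∀ x ∈ K, ∃ b ∈ C,
      u x + u t - m * u b ≤ diameter K C / 2 * (h - u b) := by
    intro u h hle x hx
    obtain ⟨b, hb, hmin⟩ := C.isCompact.exists_isMinOn C.nonempty u.continuous.continuousOn
    obtain ⟨y, hy, hyb⟩ := ht b hb
    have e := congrArg u hyb
    simp only [map_smul, map_add, smul_eq_mul] at e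
    have := sub_le_diameter_mul_width hC hx hy u (w := h - u b) fun c hc c' hc' =>
      sub_le_sub (hle c hc) (hmin hc')
    exact ⟨b, hb, by linarith⟩
  obtain ⟨b₁, hb₁, hw₁⟩ := width u₁ h₁ hle₁ x₁ hx₁
  obtain ⟨b₂, hb₂, hw₂⟩ := width u₂ h₂ hle₂ x₂ hx₂
  obtain ⟨b₃, hb₃, hw₃⟩ := width u₃ h₃ hle₃ x₃ hx₃
  -- Each `-u i (b i)` is the sum of the other two functionals at `b i`, so every `h j` is used
  -- twice.
  have hS : -(u₁ b₁ + u₂ b₂ + u₃ b₃) ≤ 2 * (h₁ + h₂ + h₃) := by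
    linarith [hu b₁, hu b₂, hu b₃, hle₂ b₁ hb₁, hle₃ b₁ hb₁, hle₁ b₂ hb₂, hle₃ b₂ hb₂,
      hle₁ b₃ hb₃, hle₂ b₃ hb₃]
  have hp := mul_le_mul_of_nonneg_left hS (sub_nonneg.2 hmd)
  refine le_of_mul_le_mul_right ?_ hH
  linarith [hu t]

theorem four_mul_inradius_add_le {K C : ConvexBody Plane}
    (hC : (interior (C : Set Plane)).Nonempty) :
    4 * inradius K C + 2 * circumradius K C ≤ 3 * diameter K C := by
  have hr := inradius_le_diameter (K := K) hC
  have hD := diameter_nonneg K C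
  by_contra! hlt
  obtain ⟨l, hl, hlR⟩ := exists_between
    (show 3 * (diameter K C / 2) - 2 * inradius K C < circumradius K C by linarith)
  have : inradius K C ≤ (3 * (diameter K C / 2) - l) / 2 :=
    inradius_le fun m _ hm => by
      linarith [circumradius_add_two_mul_le hC (by linarith : 0 ≤ l) hlR hm]
  linarith

/-! ### The inequality `D (2 R - D) ≤ 4 r R` -/

/-- Centre at `L / 2`: with `α, β, γ` the shifts of `a, b, c` and `ε = e - L / 2`, the claim is `L`
times `αβ + βγ + γα + ε² ≥ 0` on `[-ε, ε]³`. The left side is affine in `γ`, and at `γ = ±ε` it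
factors as `(ε ± α) (ε ± β)`. -/
theorem mul_add_mul_sub_ge {L e a b c : ℝ} (hL : 0 ≤ L) (ha : a ≤ e) (ha' : L - a ≤ e)
    (hb : b ≤ e) (hb' : L - b ≤ e) (hc : c ≤ e) (hc' : L - c ≤ e) :
    L * (e * (L - e)) ≤ a * b * c + (L - a) * (L - b) * (L - c) := by
  have key : 0 ≤ (a - L / 2) * (b - L / 2) + (a + b - L) * (c - L / 2) + (e - L / 2) ^ 2 := by
    rcases le_total L (a + b) with h | h
    · nlinarith [mul_nonneg (sub_nonneg.2 ha) (sub_nonneg.2 hb),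
        mul_nonneg (sub_nonneg.2 h) (sub_nonneg.2 hc')]
    · nlinarith [mul_nonneg (sub_nonneg.2 ha') (sub_nonneg.2 hb'),
        mul_nonneg (sub_nonneg.2 h) (sub_nonneg.2 hc)]
  linarith [mul_nonneg hL key]

theorem apply_eq_coordinates (u : Plane →L[ℝ] ℝ) (v : Plane) :
    u v = v 0 * u (EuclideanSpace.single 0 1) + v 1 * u (EuclideanSpace.single 1 1) := by
  have : v = v 0 • EuclideanSpace.single 0 (1 : ℝ) + v 1 • EuclideanSpace.single 1 (1 : ℝ) := by
    ext i
    fin_cases i <;> simp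
  conv_lhs => rw [this]
  simp

/-- The triangle inscribed into the triangle `x₁ x₂ x₃`, with sides along the kernels of `u₁`, `u₂`,
`u₃`. -/
theorem exists_homothety {u₁ u₂ u₃ : Plane →L[ℝ] ℝ} (hu : ∀ v, u₁ v + u₂ v + u₃ v = 0)
    (x₁ x₂ x₃ : Plane) :
    ∃ μ : ℝ, (u₁ x₁ + u₂ x₂ + u₃ x₃) * μ =
        (u₃ x₃ - u₃ x₁) * (u₁ x₁ - u₁ x₂) * (u₂ x₂ - u₂ x₃) +
        (u₂ x₂ - u₂ x₁) * (u₃ x₃ - u₃ x₂) * (u₁ x₁ - u₁ x₃) ∧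
      ∀ v, u₁ v • ((u₃ x₃ - u₃ x₁) • x₂ + (u₂ x₂ - u₂ x₁) • x₃) +
          u₂ v • ((u₃ x₃ - u₃ x₂) • x₁ + (u₁ x₁ - u₁ x₂) • x₃) +
          u₃ v • ((u₂ x₂ - u₂ x₃) • x₁ + (u₁ x₁ - u₁ x₃) • x₂) = -(μ • v) := by
  have h3 : ∀ v, u₃ v = -u₁ v - u₂ v := fun v => by linarith [hu v]
  set p := u₁ (EuclideanSpace.single 0 1)
  set q := u₁ (EuclideanSpace.single 1 1)
  set r := u₂ (EuclideanSpace.single 0 1)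
  set s := u₂ (EuclideanSpace.single 1 1)
  have h1 : ∀ v, u₁ v = v 0 * p + v 1 * q := apply_eq_coordinates u₁
  have h2 : ∀ v, u₂ v = v 0 * r + v 1 * s := apply_eq_coordinates u₂
  -- `μ` is the determinant of `(u₁, u₂)` times that of `(x₁ - x₃, x₂ - x₃)`.
  refine ⟨(p * s - q * r) *
    ((x₁ 0 - x₃ 0) * (x₂ 1 - x₃ 1) - (x₁ 1 - x₃ 1) * (x₂ 0 - x₃ 0)), ?_, fun v => ?_⟩
  · simp only [h3, h1, h2]
    ring
  · ext i
    fin_cases i <;> simp [h3, h1, h2] <;> ring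

theorem add_smul_mem_of_sum_eq_one {S : Set Plane} (hS : Convex ℝ S) {x y z : Plane} (hx : x ∈ S)
    (hy : y ∈ S) (hz : z ∈ S) {p q r : ℝ} (hp : 0 ≤ p) (hq : 0 ≤ q) (hr : 0 ≤ r)
    (h : p + q + r = 1) : p • x + q • y + r • z ∈ S := by
  have := hS.sum_mem (t := Finset.univ) (w := ![p, q, r]) (z := ![x, y, z])
    (by simp [Fin.forall_fin_succ, hp, hq, hr]) (by simp [Fin.sum_univ_three, h])
    (by simp [Fin.forall_fin_succ, hx, hy, hz])
  simpa [Fin.sum_univ_three] using this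

/-- Let `p₁ = (a x₂ + a' x₃) / L` and cyclically `p₂`, `p₃`, points on the sides of `x₁ x₂ x₃`.
Sending `v` to the combination of the `p i` with the barycentric weights `(h i - u i v) / H` is a
homothety of ratio `μ / (H L)`, and it maps `C` into `K`. Since `L μ = a b c + a' b' c'` with all
six factors at most `d H`, this ratio is at least `d (L - d H) / L`. -/
theorem le_inradius_of_lt_circumradius {K C : ConvexBody Plane}
    (hC : (interior (C : Set Plane)).Nonempty) {l : ℝ} (hdl : diameter K C / 2 < l)
    (hlR : l < circumradius K C) :
    diameter K C / 2 * (l - diameter K C / 2) ≤ inradius K C * l := by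
  have hd : 0 ≤ diameter K C / 2 := div_nonneg (diameter_nonneg _ _) zero_le_two
  set d := diameter K C / 2 with hd_def
  have hl : 0 < l := hd.trans_lt hdl
  obtain ⟨x₁, hx₁, x₂, hx₂, x₃, hx₃, u₁, u₂, u₃, h₁, h₂, h₃, hu, hle₁, hle₂, hle₃, hH, hlt⟩ :=
    exists_circumscribed_triangle hC hl.le hlR
  obtain ⟨μ, hμ, hhom⟩ := exists_homothety hu x₁ x₂ x₃
  set H := h₁ + h₂ + h₃ with hH_def
  set L := u₁ x₁ + u₂ x₂ + u₃ x₃ with hL_def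
  have hLpos : 0 < L := (mul_pos hl hH).trans hlt
  have hdL : d * H < L := (mul_lt_mul_of_pos_right hdl hH).trans hlt
  have w₁ : ∀ x ∈ K, ∀ y ∈ K, u₁ x - u₁ y ≤ d * H := fun x hx y hy =>
    sub_le_diameter_mul_width hC hx hy u₁ fun c hc c' hc' => by
      linarith [hle₁ c hc, hle₂ c' hc', hle₃ c' hc', hu c']
  have w₂ : ∀ x ∈ K, ∀ y ∈ K, u₂ x - u₂ y ≤ d * H := fun x hx y hy =>
    sub_le_diameter_mul_width hC hx hy u₂ fun c hc c' hc' => by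
      linarith [hle₂ c hc, hle₁ c' hc', hle₃ c' hc', hu c']
  have w₃ : ∀ x ∈ K, ∀ y ∈ K, u₃ x - u₃ y ≤ d * H := fun x hx y hy =>
    sub_le_diameter_mul_width hC hx hy u₃ fun c hc c' hc' => by
      linarith [hle₃ c hc, hle₁ c' hc', hle₂ c' hc', hu c']
  have a_le := w₃ x₃ hx₃ x₁ hx₁
  have a'_le := w₂ x₂ hx₂ x₁ hx₁
  have b_le := w₁ x₁ hx₁ x₂ hx₂
  have b'_le := w₃ x₃ hx₃ x₂ hx₂
  have c_le := w₂ x₂ hx₂ x₃ hx₃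
  have c'_le := w₁ x₁ hx₁ x₃ hx₃
  have hsum_a : (u₃ x₃ - u₃ x₁) + (u₂ x₂ - u₂ x₁) = L := by linarith [hu x₁]
  have hsum_b : (u₁ x₁ - u₁ x₂) + (u₃ x₃ - u₃ x₂) = L := by linarith [hu x₂]
  have hsum_c : (u₂ x₂ - u₂ x₃) + (u₁ x₁ - u₁ x₃) = L := by linarith [hu x₃]
  set a := u₃ x₃ - u₃ x₁
  set a' := u₂ x₂ - u₂ x₁
  set b := u₁ x₁ - u₁ x₂
  set b' := u₃ x₃ - u₃ x₂
  set c := u₂ x₂ - u₂ x₃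
  set c' := u₁ x₁ - u₁ x₃
  have hμ_ge : d * H * (L - d * H) ≤ μ := by
    have := mul_add_mul_sub_ge hLpos.le a_le (by linarith) b_le (by linarith) c_le (by linarith)
    rw [← hsum_a, add_sub_cancel_left, hsum_a, ← hsum_b, add_sub_cancel_left, hsum_b, ← hsum_c,
      add_sub_cancel_left, hsum_c, ← hμ] at this
    exact le_of_mul_le_mul_left this hLpos
  have hμ0 : 0 ≤ μ := le_trans (mul_nonneg (mul_nonneg hd hH.le) (sub_nonneg.2 hdL.le)) hμ_ge
  have hr : μ / (H * L) ≤ inradius K C := by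
    refine le_inradius hC (div_nonneg hμ0 (mul_pos hH hLpos).le)
      ⟨-((H * L)⁻¹ • (h₁ • (a • x₂ + a' • x₃) + h₂ • (b' • x₁ + b • x₃) +
        h₃ • (c • x₁ + c' • x₂))), smul_subset_vadd_iff.2 fun v hv => ?_⟩
    have p₁ := sub_nonneg.2 (hle₁ v hv)
    have p₂ := sub_nonneg.2 (hle₂ v hv)
    have p₃ := sub_nonneg.2 (hle₃ v hv)
    have hmem : ((H * L)⁻¹ * ((h₂ - u₂ v) * b' + (h₃ - u₃ v) * c)) • x₁ +
        ((H * L)⁻¹ * ((h₁ - u₁ v) * a + (h₃ - u₃ v) * c')) • x₂ +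
        ((H * L)⁻¹ * ((h₁ - u₁ v) * a' + (h₂ - u₂ v) * b)) • x₃ ∈ K := by
      have hi : 0 ≤ (H * L)⁻¹ := (inv_pos.2 (mul_pos hH hLpos)).le
      refine add_smul_mem_of_sum_eq_one K.convex hx₁ hx₂ hx₃
        (mul_nonneg hi (add_nonneg (mul_nonneg p₂ ?_) (mul_nonneg p₃ ?_)))
        (mul_nonneg hi (add_nonneg (mul_nonneg p₁ ?_) (mul_nonneg p₃ ?_)))
        (mul_nonneg hi (add_nonneg (mul_nonneg p₁ ?_) (mul_nonneg p₂ ?_))) ?_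
      all_goals try linarith
      have : H * L = (h₁ - u₁ v) * L + (h₂ - u₂ v) * L + (h₃ - u₃ v) * L := by
        rw [hH_def]
        linear_combination L * hu v
      rw [← mul_add, ← mul_add, inv_mul_eq_one₀ (mul_pos hH hLpos).ne', this]
      linear_combination -(h₁ - u₁ v) * hsum_a - (h₂ - u₂ v) * hsum_b - (h₃ - u₃ v) * hsum_c
    refine ⟨_, hmem, ?_⟩
    rw [show (μ / (H * L)) • v = -((H * L)⁻¹ • -(μ • v)) by module, ← hhom v]
    module
  rw [div_le_iff₀ (mul_pos hH hLpos)] at hr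
  have h1 : d * (L - d * H) ≤ inradius K C * L := by
    refine le_of_mul_le_mul_left ?_ hH
    linarith
  -- The bound reads `(d - r) L ≤ d² H`; as `r ≤ d`, `L` may be lowered to `l H`.
  have h2 := mul_le_mul_of_nonneg_left hlt.le (sub_nonneg.2 (inradius_le_diameter (K := K) hC))
  rw [← hd_def] at h2
  refine le_of_mul_le_mul_right ?_ hH
  linarith

theorem diameter_mul_le {K C : ConvexBody Plane} (hC : (interior (C : Set Plane)).Nonempty) :
    diameter K C * (2 * circumradius K C - diameter K C) ≤ 4 * inradius K C * circumradius K C := by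
  have hR := diameter_le_two_mul_circumradius (K := K) hC
  have hD := diameter_nonneg K C
  have hrn := inradius_nonneg (K : Set Plane) C
  have hrd := inradius_le_diameter (K := K) hC
  suffices diameter K C / 2 * (circumradius K C - diameter K C / 2) ≤
      inradius K C * circumradius K C by linarith
  rcases hR.eq_or_lt with h | h
  · rw [h, mul_div_cancel_left₀ _ two_ne_zero, sub_self, mul_zero]
    exact mul_nonneg hrn (circumradius_nonneg _ _)
  · have h' : diameter K C / 2 < circumradius K C := by linarith
    by_contra! hlt
    have hpos : 0 < diameter K C / 2 - inradius K C := by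
      by_contra! h0
      nlinarith [mul_le_mul_of_nonneg_right h0 (circumradius_nonneg (K : Set Plane) C),
        sq_nonneg (diameter K C)]
    -- The negated claim is `d² < (d - r) R`, which persists for some `l < R`, where the lemma
    -- applies.
    have hlt' : (diameter K C / 2) ^ 2 / (diameter K C / 2 - inradius K C) < circumradius K C := by
      rw [div_lt_iff₀ hpos]
      linarith
    obtain ⟨l, hl, hlR⟩ := exists_between (max_lt h' hlt')
    rw [max_lt_iff, div_lt_iff₀ hpos] at hl
    linarith [le_inradius_of_lt_circumradius hC hl.1 hlR]

/-! ### Truncated triangles with a triangular gauge -/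

/-- A closed half-plane. -/
def halfPlane (a b k : ℝ) : Set Plane := {p | a * p 0 + b * p 1 ≤ k}

theorem convex_halfPlane (a b k : ℝ) : Convex ℝ (halfPlane a b k) := by
  intro x hx y hy s t hs ht hst
  simp only [halfPlane, Set.mem_ofPred_eq, PiLp.add_apply, PiLp.smul_apply, smul_eq_mul] at *
  obtain rfl : t = 1 - s := by linarith
  linarith [mul_le_mul_of_nonneg_left hx hs, mul_le_mul_of_nonneg_left hy ht]

theorem isClosed_halfPlane (a b k : ℝ) : IsClosed (halfPlane a b k) :=
  isClosed_le (by fun_prop) continuous_const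

theorem isCompact_standardTriangle :
    IsCompact (halfPlane (-1) 0 0 ∩ halfPlane 0 (-1) 0 ∩ halfPlane 1 1 1) := by
  refine (isCompact_closedBall (0 : Plane) 2).of_isClosed_subset
    (((isClosed_halfPlane _ _ _).inter (isClosed_halfPlane _ _ _)).inter
      (isClosed_halfPlane _ _ _)) ?_
  rintro p ⟨⟨h0, h1⟩, h2⟩
  simp only [halfPlane, Set.mem_ofPred_eq] at h0 h1 h2
  rw [mem_closedBall_zero_iff, EuclideanSpace.norm_eq, Real.sqrt_le_left zero_le_two,
    Fin.sum_univ_two, Real.norm_eq_abs, Real.norm_eq_abs, sq_abs, sq_abs]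
  nlinarith

/-- The triangle with vertices `0`, `(1, 0)` and `(0, 1)`. -/
def standardTriangle : ConvexBody Plane where
  carrier := halfPlane (-1) 0 0 ∩ halfPlane 0 (-1) 0 ∩ halfPlane 1 1 1
  convex' := ((convex_halfPlane _ _ _).inter (convex_halfPlane _ _ _)).inter (convex_halfPlane _ _ _)
  isCompact' := isCompact_standardTriangle
  nonempty' := ⟨0, by simp [halfPlane]⟩

theorem mem_standardTriangle {p : Plane} :
    p ∈ standardTriangle ↔ 0 ≤ p 0 ∧ 0 ≤ p 1 ∧ p 0 + p 1 ≤ 1 := by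
  change p ∈ halfPlane (-1) 0 0 ∩ halfPlane 0 (-1) 0 ∩ halfPlane 1 1 1 ↔ _
  simp [halfPlane, and_assoc]

theorem interior_standardTriangle_nonempty : (interior (standardTriangle : Set Plane)).Nonempty := by
  refine ⟨!₂[1 / 4, 1 / 4], mem_interior.2 ⟨{p | 0 < p 0} ∩ {p | 0 < p 1} ∩ {p | p 0 + p 1 < 1},
    ?_, ?_, ?_⟩⟩
  · rintro p ⟨⟨h0, h1⟩, h2⟩
    exact mem_standardTriangle.2 ⟨le_of_lt h0, le_of_lt h1, le_of_lt h2⟩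
  · exact ((isOpen_lt continuous_const (by fun_prop)).inter
      (isOpen_lt continuous_const (by fun_prop))).inter (isOpen_lt (by fun_prop) continuous_const)
  · norm_num

/-- The truncation of the standard triangle by three half-planes that contains
`f • Q + (1 - f) • T`, where `T` is the standard triangle and `Q` is the triangle with vertices
`(0, b)`, `(1 - b, 0)` and `(1 - b, b)`, and has the same radii. -/
def truncatedTriangleSet (f b : ℝ) : Set Plane :=
  (standardTriangle : Set Plane) ∩ (halfPlane 1 0 (1 - f * b) ∩ halfPlane 0 1 (1 - f + f * b) ∩
    halfPlane (-1) (-1) (-(f * b)) ∩ halfPlane (-b) (-(1 - b)) (-(f * (1 - b) * b)))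

theorem mem_truncatedTriangleSet {f b : ℝ} {p : Plane} :
    p ∈ truncatedTriangleSet f b ↔ (0 ≤ p 0 ∧ 0 ≤ p 1 ∧ p 0 + p 1 ≤ 1) ∧ p 0 ≤ 1 - f * b ∧
      p 1 ≤ 1 - f + f * b ∧ f * b ≤ p 0 + p 1 ∧ f * (1 - b) * b ≤ b * p 0 + (1 - b) * p 1 := by
  have h3 : p ∈ halfPlane (-1) (-1) (-(f * b)) ↔ f * b ≤ p 0 + p 1 := by
    rw [halfPlane, Set.mem_ofPred_eq]
    constructor <;> intro h <;> linarith
  have h4 : p ∈ halfPlane (-b) (-(1 - b)) (-(f * (1 - b) * b)) ↔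
      f * (1 - b) * b ≤ b * p 0 + (1 - b) * p 1 := by
    rw [halfPlane, Set.mem_ofPred_eq]
    constructor <;> intro h <;> linarith
  rw [truncatedTriangleSet, Set.mem_inter_iff, Set.mem_inter_iff, Set.mem_inter_iff,
    Set.mem_inter_iff, h3, h4, SetLike.mem_coe, mem_standardTriangle]
  simp [halfPlane, and_assoc]

section Truncated

variable {f b : ℝ}

theorem left_point_mem (hf : 0 ≤ f) (hf' : f ≤ 1) (hb : 0 ≤ b) (hb' : b ≤ 1 / 2) :
    !₂[0, 1 - f + f * b] ∈ truncatedTriangleSet f b := by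
  have hfb := mul_nonneg hf hb
  have hfb' := mul_nonneg hf (by linarith : 0 ≤ 1 / 2 - b)
  rw [mem_truncatedTriangleSet]
  simp only [Matrix.cons_val_zero, Matrix.cons_val_one]
  refine ⟨⟨le_rfl, ?_, ?_⟩, ?_, le_rfl, ?_, ?_⟩ <;> nlinarith

theorem bottom_point_mem (hf : 0 ≤ f) (hf' : f ≤ 1) (hb : 0 ≤ b) (hb' : b ≤ 1 / 2) :
    !₂[1 - f * b, 0] ∈ truncatedTriangleSet f b := by
  have hfb := mul_nonneg hf hb
  have hfb' := mul_nonneg hf (by linarith : 0 ≤ 1 / 2 - b)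
  rw [mem_truncatedTriangleSet]
  simp only [Matrix.cons_val_zero, Matrix.cons_val_one]
  refine ⟨⟨?_, le_rfl, ?_⟩, le_rfl, ?_, ?_, ?_⟩ <;> nlinarith

theorem diagonal_point_mem (hf : 0 ≤ f) (hf' : f ≤ 1) (hb : 0 ≤ b) (hb' : b ≤ 1 / 2) :
    !₂[1 - f * b, f * b] ∈ truncatedTriangleSet f b := by
  have hfb := mul_nonneg hf hb
  have hfb' := mul_nonneg hf (by linarith : 0 ≤ 1 / 2 - b)
  rw [mem_truncatedTriangleSet]
  simp only [Matrix.cons_val_zero, Matrix.cons_val_one]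
  refine ⟨⟨?_, hfb, ?_⟩, le_rfl, ?_, ?_, ?_⟩ <;> nlinarith

/-- The convex body given by `truncatedTriangleSet`. -/
def truncatedTriangle (f b : ℝ) (hf : 0 ≤ f) (hf' : f ≤ 1) (hb : 0 ≤ b) (hb' : b ≤ 1 / 2) :
    ConvexBody Plane where
  carrier := truncatedTriangleSet f b
  convex' := standardTriangle.convex.inter ((((convex_halfPlane _ _ _).inter
    (convex_halfPlane _ _ _)).inter (convex_halfPlane _ _ _)).inter (convex_halfPlane _ _ _))
  isCompact' := standardTriangle.isCompact.inter_right ((((isClosed_halfPlane _ _ _).inter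
    (isClosed_halfPlane _ _ _)).inter (isClosed_halfPlane _ _ _)).inter (isClosed_halfPlane _ _ _))
  nonempty' := ⟨_, left_point_mem hf hf' hb hb'⟩

variable (hf : 0 ≤ f) (hf' : f ≤ 1) (hb : 0 ≤ b) (hb' : b ≤ 1 / 2)

theorem truncatedTriangle_nontrivial :
    (truncatedTriangle f b hf hf' hb hb' : Set Plane).Nontrivial := by
  refine ⟨_, left_point_mem hf hf' hb hb', _, bottom_point_mem hf hf' hb hb', fun h => ?_⟩
  have h0 := congrArg (fun p : Plane => p 0) h
  simp only [Matrix.cons_val_zero] at h0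
  nlinarith

theorem circumradius_truncatedTriangle :
    circumradius (truncatedTriangle f b hf hf' hb hb') standardTriangle = 1 := by
  refine le_antisymm (circumradius_le zero_le_one ⟨0, ?_⟩)
    (le_csInf (exists_translate_subset (ConvexBody.isBounded _)
      interior_standardTriangle_nonempty) ?_)
  · rw [zero_vadd, one_smul]
    exact Set.inter_subset_left
  -- The three marked points lie one on each side of the standard triangle, so summing the side
  -- constraints cancels `t`.
  · rintro l ⟨hl, t, ht⟩
    rw [vadd_subset_smul_iff] at ht
    obtain ⟨c₁, hc₁, e₁⟩ := ht _ (left_point_mem hf hf' hb hb')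
    obtain ⟨c₂, hc₂, e₂⟩ := ht _ (bottom_point_mem hf hf' hb hb')
    obtain ⟨c₃, hc₃, e₃⟩ := ht _ (diagonal_point_mem hf hf' hb hb')
    have k₁ := mul_nonneg hl (mem_standardTriangle.1 hc₁).1
    have k₂ := mul_nonneg hl (mem_standardTriangle.1 hc₂).2.1
    have k₃ := mul_le_mul_of_nonneg_left (mem_standardTriangle.1 hc₃).2.2 hl
    have e₁ := congrArg (fun p : Plane => p 0) e₁
    have e₂ := congrArg (fun p : Plane => p 1) e₂
    have e₃₀ := congrArg (fun p : Plane => p 0) e₃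
    have e₃₁ := congrArg (fun p : Plane => p 1) e₃
    simp only [PiLp.add_apply, PiLp.smul_apply, smul_eq_mul, Matrix.cons_val_zero,
      Matrix.cons_val_one] at e₁ e₂ e₃₀ e₃₁
    linarith

/-- The hypotheses say that `x - y` lies in `d (T - T)`, a hexagon, for the standard triangle `T`.
Translating the coordinatewise minimum of the pair to the origin places both points in `d T`. -/
theorem circumradius_pair_standardTriangle_le {x y : Plane} {d : ℝ} (hd : 0 < d)
    (h0 : |x 0 - y 0| ≤ d) (h1 : |x 1 - y 1| ≤ d) (h2 : |x 0 + x 1 - (y 0 + y 1)| ≤ d) :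
    circumradius {x, y} standardTriangle ≤ d := by
  have key : ∀ t z : Plane, 0 ≤ (t + z) 0 → 0 ≤ (t + z) 1 → (t + z) 0 + (t + z) 1 ≤ d →
      ∃ c ∈ standardTriangle, d • c = t + z := by
    intro t z k0 k1 k2
    refine ⟨d⁻¹ • (t + z), mem_standardTriangle.2 ?_, smul_inv_smul₀ hd.ne' _⟩
    simp only [PiLp.smul_apply, smul_eq_mul]
    have := inv_pos.2 hd
    refine ⟨by positivity, by positivity, ?_⟩
    rw [← mul_add, inv_mul_le_iff₀ hd]
    linarith
  refine circumradius_le hd.le ⟨!₂[-min (x 0) (y 0), -min (x 1) (y 1)],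
    vadd_subset_smul_iff.2 ?_⟩
  rw [abs_le] at h0 h1 h2
  have hx : x 0 + x 1 ≤ d + min (x 0) (y 0) + min (x 1) (y 1) := by
    rcases min_cases (x 0) (y 0) with h | h <;> rcases min_cases (x 1) (y 1) with h' | h' <;>
      linarith
  have hy : y 0 + y 1 ≤ d + min (x 0) (y 0) + min (x 1) (y 1) := by
    rcases min_cases (x 0) (y 0) with h | h <;> rcases min_cases (x 1) (y 1) with h' | h' <;>
      linarith
  have mx₀ := min_le_left (x 0) (y 0)
  have my₀ := min_le_right (x 0) (y 0)
  have mx₁ := min_le_left (x 1) (y 1)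
  have my₁ := min_le_right (x 1) (y 1)
  rintro z hz
  obtain hz | hz : z = x ∨ z = y := hz <;> subst hz <;> refine key _ _ ?_ ?_ ?_ <;>
    simp only [PiLp.add_apply, Matrix.cons_val_zero, Matrix.cons_val_one] <;> linarith

theorem diameter_truncatedTriangle :
    diameter (truncatedTriangle f b hf hf' hb hb') standardTriangle = 2 * (1 - f * b) := by
  have hd : 0 < 1 - f * b := by nlinarith
  refine le_antisymm (diameter_le fun x hx y hy => ?_) ?_
  · obtain ⟨⟨x0, x1, x2⟩, x3, x4, x5, -⟩ := mem_truncatedTriangleSet.1 hx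
    obtain ⟨⟨y0, y1, y2⟩, y3, y4, y5, -⟩ := mem_truncatedTriangleSet.1 hy
    have : f * b ≤ f * (1 / 2) := mul_le_mul_of_nonneg_left hb' hf
    refine circumradius_pair_standardTriangle_le hd ?_ ?_ ?_ <;> rw [abs_le] <;>
      constructor <;> linarith
  · let u : Plane →L[ℝ] ℝ := EuclideanSpace.proj 0
    have hw : ∀ c ∈ standardTriangle, ∀ c' ∈ standardTriangle, u c - u c' ≤ 1 := by
      intro c hc c' hc'
      rw [mem_standardTriangle] at hc hc'
      change c 0 - c' 0 ≤ 1
      linarith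
    have := sub_le_diameter_mul_width (K := truncatedTriangle f b hf hf' hb hb')
      interior_standardTriangle_nonempty (bottom_point_mem hf hf' hb hb')
      (left_point_mem hf hf' hb hb') u hw
    change (1 - f * b) - 0 ≤ _ at this
    linarith

theorem inradius_truncatedTriangle :
    inradius (truncatedTriangle f b hf hf' hb hb') standardTriangle = 1 - f + f * ((1 - b) * b) := by
  have h1b : 0 ≤ 1 - b := by linarith
  have hfb := mul_nonneg hf hb
  refine le_antisymm (inradius_le fun l hl h => ?_)
    (le_inradius interior_standardTriangle_nonempty ?_ ?_)
  · obtain ⟨t, ht⟩ := h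
    rw [smul_subset_vadd_iff] at ht
    obtain ⟨x, hx, ex⟩ := ht !₂[1, 0] (mem_standardTriangle.2 (by simp))
    obtain ⟨y, hy, ey⟩ := ht !₂[0, 1] (mem_standardTriangle.2 (by simp))
    obtain ⟨z, hz, ez⟩ := ht 0 (mem_standardTriangle.2 (by simp))
    have k₁ := (mem_truncatedTriangleSet.1 hx).2.1
    have k₂ := (mem_truncatedTriangleSet.1 hy).2.2.1
    have k₃ := (mem_truncatedTriangleSet.1 hz).2.2.2.2
    have ex := congrArg (fun p : Plane => p 0) ex
    have ey := congrArg (fun p : Plane => p 1) ey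
    have ez₀ := congrArg (fun p : Plane => p 0) ez
    have ez₁ := congrArg (fun p : Plane => p 1) ez
    simp only [PiLp.add_apply, PiLp.smul_apply, smul_eq_mul, smul_zero,
      PiLp.zero_apply, Matrix.cons_val_zero, Matrix.cons_val_one] at ex ey ez₀ ez₁
    -- The weights `b`, `1 - b`, `1` make the normals of these three half-planes sum to zero, so the
    -- translation drops out.
    have m₁ := mul_le_mul_of_nonneg_left k₁ hb
    have m₂ := mul_le_mul_of_nonneg_left k₂ h1b
    obtain rfl : l = t 0 + x 0 := by linarith
    obtain hz₀ : z 0 = -t 0 := by linarith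
    obtain hz₁ : z 1 = -t 1 := by linarith
    rw [hz₀, hz₁] at k₃
    have hyl : y 1 = t 0 + x 0 - t 1 := by linarith
    rw [hyl] at m₂
    linarith
  · have := mul_nonneg hf (mul_nonneg h1b hb)
    linarith
  -- This corner makes those same three constraints tight.
  · refine ⟨-!₂[f * (1 - b) ^ 2, f * b ^ 2], smul_subset_vadd_iff.2 fun c hc => ?_⟩
    obtain ⟨c0, c1, c2⟩ := mem_standardTriangle.1 hc
    refine ⟨!₂[f * (1 - b) ^ 2, f * b ^ 2] + (1 - f + f * ((1 - b) * b)) • c, ?_,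
      neg_add_cancel_left _ _⟩
    have hs : 0 ≤ 1 - f + f * ((1 - b) * b) := by
      have := mul_nonneg hf (mul_nonneg h1b hb)
      linarith
    have e0 := mul_nonneg hs c0
    have e1 := mul_nonneg hs c1
    have e2 := mul_le_mul_of_nonneg_left c2 hs
    have e3 : (1 - f + f * ((1 - b) * b)) * c 0 ≤ (1 - f + f * ((1 - b) * b)) := by nlinarith
    have e4 : (1 - f + f * ((1 - b) * b)) * c 1 ≤ (1 - f + f * ((1 - b) * b)) := by nlinarith
    refine mem_truncatedTriangleSet.2 ?_
    simp only [PiLp.add_apply, PiLp.smul_apply, smul_eq_mul, Matrix.cons_val_zero,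
      Matrix.cons_val_one]
    rw [mul_add, mul_one] at e2
    generalize (1 - f + f * ((1 - b) * b)) * c 0 = X at *
    generalize (1 - f + f * ((1 - b) * b)) * c 1 = Y at *
    have g1 := mul_nonneg hf (sq_nonneg (1 - b))
    have g2 := mul_nonneg hf (sq_nonneg b)
    have g3 := mul_nonneg hb e0
    have g4 := mul_nonneg h1b e1
    have g5 := mul_nonneg hf (mul_nonneg h1b hb)
    have g6 := mul_nonneg hf (mul_nonneg h1b (by linarith : 0 ≤ 1 - 2 * b))
    refine ⟨⟨?_, ?_, ?_⟩, ?_, ?_, ?_, ?_⟩ <;> linarith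

theorem radiiPoint_truncatedTriangle :
    radiiPoint (truncatedTriangle f b hf hf' hb hb') standardTriangle =
      (1 - f + f * ((1 - b) * b), 1 - f * b) := by
  rw [radiiPoint, circumradius_truncatedTriangle, diameter_truncatedTriangle,
    inradius_truncatedTriangle, div_one, mul_one, mul_div_cancel_left₀ _ two_ne_zero]

end Truncated

/-! ### The diagram and its boundary -/

/-- The region described by the three inequalities. -/
def region : Set (ℝ × ℝ) := {p | p.2 ≤ 1 ∧ 2 * p.1 + 1 ≤ 3 * p.2 ∧ p.2 * (1 - p.2) ≤ p.1}

/-- Eliminating `x` from the last two inequalities gives `(2 y - 1) (y + 1) ≥ 0`. -/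
theorem half_le_of_mem_region {p : ℝ × ℝ} (hp : p ∈ region) (h0 : 0 ≤ p.1) : 1 / 2 ≤ p.2 := by
  obtain ⟨h1, h2, h3⟩ := hp
  by_contra! h
  have : 1 / 3 ≤ p.2 := by linarith
  nlinarith

theorem radiiPoint_mem {K C : ConvexBody Plane} (hK : (K : Set Plane).Nontrivial)
    (hC : (interior (C : Set Plane)).Nonempty) :
    (radiiPoint K C).1 ∈ Set.Icc (0 : ℝ) 1 ∧ (radiiPoint K C).2 ∈ Set.Icc (0 : ℝ) 1 ∧
      radiiPoint K C ∈ region := by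
  have hR := circumradius_pos hC hK
  have hr := inradius_nonneg (K : Set Plane) C
  have hD := diameter_nonneg K C
  have h1 := diameter_le_two_mul_circumradius (K := K) hC
  have h2 := four_mul_inradius_add_le (K := K) hC
  have h3 := diameter_mul_le (K := K) hC
  have hx : (radiiPoint K C).1 * circumradius K C = inradius K C := div_mul_cancel₀ _ hR.ne'
  have hy : (radiiPoint K C).2 * circumradius K C * 2 = diameter K C := by
    rw [mul_assoc, mul_comm (circumradius _ _)]
    exact div_mul_cancel₀ _ (by positivity)
  set x := (radiiPoint K C).1
  set y := (radiiPoint K C).2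
  rw [← hx] at h2 h3 hr
  rw [← hy] at h1 h2 h3 hD
  have hx0 : 0 ≤ x := nonneg_of_mul_nonneg_left hr hR
  have hy0 : 0 ≤ y := nonneg_of_mul_nonneg_left (by linarith : 0 ≤ y * circumradius K C) hR
  have hy1 : y ≤ 1 := le_of_mul_le_mul_right (by linarith) hR
  have hxy : 2 * x + 1 ≤ 3 * y := le_of_mul_le_mul_right (by linarith) hR
  refine ⟨⟨hx0, by linarith⟩, ⟨hy0, hy1⟩, hy1, hxy, ?_⟩
  refine le_of_mul_le_mul_right ?_ (mul_pos hR hR)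
  change y * (1 - y) * _ ≤ x * _
  linarith

/-- Every point of the region lies on a segment from `(1, 1)` to a point of the curve
`x = y * (1 - y)`. -/
theorem exists_parameters {x y : ℝ} (hx : 0 ≤ x) (h : (x, y) ∈ region) :
    ∃ f b : ℝ, 0 ≤ f ∧ f ≤ 1 ∧ 0 ≤ b ∧ b ≤ 1 / 2 ∧ 1 - f + f * ((1 - b) * b) = x ∧
      1 - f * b = y := by
  have hy := half_le_of_mem_region h hx
  obtain ⟨h1, h2, h3⟩ := h
  simp only at h1 h2 h3 hy
  rcases h1.eq_or_lt with rfl | hlt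
  · exact ⟨1 - x, 0, by linarith, by linarith, le_rfl, by norm_num, by ring, by ring⟩
  · have hpos : 0 < 1 - y := by linarith
    -- The second coordinate forces `f = (1 - y) / b`, and `g b` is then the first. Its values at `b
    -- = 1 - y` and `b = 1 / 2` are `y (1 - y)` and `(3 y - 1) / 2`, exactly the bounds on `x`.
    let g : ℝ → ℝ := fun b => 1 - (1 - y) / b + (1 - y) * (1 - b)
    have hg : ContinuousOn g (Set.Icc (1 - y) (1 / 2)) := by
      have : ∀ b ∈ Set.Icc (1 - y) (1 / 2), b ≠ 0 := fun b hb => (hpos.trans_le hb.1).ne'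
      fun_prop (disch := assumption)
    have hx_mem : x ∈ Set.Icc (g (1 - y)) (g (1 / 2)) := by
      simp only [g, Set.mem_Icc, div_self hpos.ne']
      constructor <;> linarith
    obtain ⟨b, ⟨hb, hb'⟩, hbx⟩ := intermediate_value_Icc (by linarith) hg hx_mem
    have hb0 : 0 < b := hpos.trans_le hb
    refine ⟨(1 - y) / b, b, by positivity, (div_le_one hb0).2 hb, hb0.le, hb', ?_, ?_⟩
    · rw [← hbx]
      simp only [g]
      field_simp
    · rw [div_mul_cancel₀ _ hb0.ne']
      ring

theorem unionDiagram_eq :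
    unionDiagram = {p : ℝ × ℝ | p.1 ∈ Set.Icc (0 : ℝ) 1 ∧ p.2 ∈ Set.Icc (0 : ℝ) 1 ∧
      p.2 ≤ 1 ∧ 2 * p.1 + 1 ≤ 3 * p.2 ∧ p.2 * (1 - p.2) ≤ p.1} := by
  ext ⟨x, y⟩
  constructor
  · rintro ⟨K, C, hK, hC, h⟩
    rw [h]
    exact radiiPoint_mem hK hC
  · rintro ⟨hx, -, h⟩
    obtain ⟨f, b, hf, hf', hb, hb', rfl, rfl⟩ := exists_parameters hx.1 h
    exact ⟨_, _, truncatedTriangle_nontrivial hf hf' hb hb', interior_standardTriangle_nonempty,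
      (radiiPoint_truncatedTriangle hf hf' hb hb').symm⟩

theorem isClosed_unionDiagram : IsClosed unionDiagram := by
  rw [unionDiagram_eq]
  have h1 : IsClosed {p : ℝ × ℝ | p.2 ≤ 1} := isClosed_le (by fun_prop) (by fun_prop)
  have h2 : IsClosed {p : ℝ × ℝ | 2 * p.1 + 1 ≤ 3 * p.2} :=
    isClosed_le (by fun_prop) (by fun_prop)
  have h3 : IsClosed {p : ℝ × ℝ | p.2 * (1 - p.2) ≤ p.1} :=
    isClosed_le (by fun_prop) (by fun_prop)
  exact (isClosed_Icc.preimage continuous_fst).inter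
    ((isClosed_Icc.preimage continuous_snd).inter (h1.inter (h2.inter h3)))

theorem mem_interior_unionDiagram_iff {p : ℝ × ℝ} :
    p ∈ interior unionDiagram ↔ p ∈ unionDiagram ∧
      ¬(p.2 = 1 ∨ 2 * p.1 + 1 = 3 * p.2 ∨ p.2 * (1 - p.2) = p.1) := by
  constructor
  · intro hp
    refine ⟨interior_subset hp, ?_⟩
    obtain ⟨ε, hε, hball⟩ := Metric.mem_nhds_iff.1 (mem_interior_iff_mem_nhds.1 hp)
    have move : ∀ s t : ℝ, |s| < ε → |t| < ε → (p.1 + s, p.2 + t) ∈ unionDiagram := by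
      intro s t hs ht
      refine hball ?_
      rw [Metric.mem_ball, Prod.dist_eq, max_lt_iff, Real.dist_eq, Real.dist_eq,
        add_sub_cancel_left, add_sub_cancel_left]
      exact ⟨hs, ht⟩
    simp only [unionDiagram_eq, Set.mem_ofPred_eq] at move
    have hε' : |ε / 2| < ε := by
      rw [abs_of_pos (by positivity)]
      linarith
    have h0 : |(0 : ℝ)| < ε := by simpa using hε
    -- Moving up, right and left violates the first, second and third inequality, respectively, when
    -- it is tight.
    obtain ⟨-, -, a1, -, -⟩ := move 0 (ε / 2) h0 hε'
    obtain ⟨-, -, -, a2, -⟩ := move (ε / 2) 0 hε' h0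
    obtain ⟨-, -, -, -, a3⟩ := move (-(ε / 2)) 0 (by rwa [abs_neg]) h0
    rw [add_zero] at a2 a3
    rintro (h | h | h) <;> linarith
  · rintro ⟨hp, hne⟩
    rw [unionDiagram_eq] at hp
    obtain ⟨hx, hy, h1, h2, h3⟩ := hp
    push Not at hne
    have h1 := lt_of_le_of_ne h1 hne.1
    have h2 := lt_of_le_of_ne h2 hne.2.1
    have h3 := lt_of_le_of_ne h3 hne.2.2
    -- The box adds no boundary: the three strict inequalities together with `p.1 ≥ 0` already force
    -- both coordinates to be positive.
    refine mem_interior.2 ⟨{q | 0 < q.1} ∩ {q | 0 < q.2} ∩ {q | q.2 < 1} ∩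
      {q | 2 * q.1 + 1 < 3 * q.2} ∩ {q | q.2 * (1 - q.2) < q.1}, ?_, ?_, ?_⟩
    · rintro q ⟨⟨⟨⟨q1, q2⟩, q3⟩, q4⟩, q5⟩
      simp only [Set.mem_ofPred_eq] at q1 q2 q3 q4 q5
      rw [unionDiagram_eq]
      exact ⟨⟨q1.le, by linarith⟩, ⟨q2.le, q3.le⟩, q3.le, q4.le, q5.le⟩
    · exact ((((isOpen_lt (by fun_prop) (by fun_prop)).inter
        (isOpen_lt (by fun_prop) (by fun_prop))).inter
        (isOpen_lt (by fun_prop) (by fun_prop))).inter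
        (isOpen_lt (by fun_prop) (by fun_prop))).inter (isOpen_lt (by fun_prop) (by fun_prop))
    · have hy0 : 0 < p.2 := by linarith [hx.1]
      have hx0 : 0 < p.1 := (mul_pos hy0 (sub_pos.2 h1)).trans h3
      exact ⟨⟨⟨⟨hx0, hy0⟩, h1⟩, h2⟩, h3⟩

theorem frontier_unionDiagram :
    frontier unionDiagram =
      {p : ℝ × ℝ | p.1 ∈ Set.Icc (0 : ℝ) 1 ∧ p.2 ∈ Set.Icc (0 : ℝ) 1 ∧
        (p.2 ≤ 1 ∧ 2 * p.1 + 1 ≤ 3 * p.2 ∧ p.2 * (1 - p.2) ≤ p.1) ∧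
        (p.2 = 1 ∨ 2 * p.1 + 1 = 3 * p.2 ∨ p.2 * (1 - p.2) = p.1)} := by
  ext p
  rw [isClosed_unionDiagram.frontier_eq, Set.mem_sdiff, mem_interior_unionDiagram_iff,
    unionDiagram_eq]
  simp only [Set.mem_ofPred_eq]
  tauto

end RadiiDiagram

theorem theorem1p1 :
    (∀ K C : ConvexBody RadiiDiagram.Plane,
      (interior (C : Set RadiiDiagram.Plane)).Nonempty →
        RadiiDiagram.diameter K C ≤ 2 * RadiiDiagram.circumradius K C ∧
        4 * RadiiDiagram.inradius K C + 2 * RadiiDiagram.circumradius K C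
          ≤ 3 * RadiiDiagram.diameter K C ∧
        RadiiDiagram.diameter K C
            * (2 * RadiiDiagram.circumradius K C - RadiiDiagram.diameter K C)
          ≤ 4 * RadiiDiagram.inradius K C * RadiiDiagram.circumradius K C) ∧
    RadiiDiagram.unionDiagram =
      {p : ℝ × ℝ | p.1 ∈ Set.Icc (0 : ℝ) 1 ∧ p.2 ∈ Set.Icc (0 : ℝ) 1 ∧
        p.2 ≤ 1 ∧ 2 * p.1 + 1 ≤ 3 * p.2 ∧ p.2 * (1 - p.2) ≤ p.1} ∧
    frontier RadiiDiagram.unionDiagram =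
      {p : ℝ × ℝ | p.1 ∈ Set.Icc (0 : ℝ) 1 ∧ p.2 ∈ Set.Icc (0 : ℝ) 1 ∧
        (p.2 ≤ 1 ∧ 2 * p.1 + 1 ≤ 3 * p.2 ∧ p.2 * (1 - p.2) ≤ p.1) ∧
        (p.2 = 1 ∨ 2 * p.1 + 1 = 3 * p.2 ∨ p.2 * (1 - p.2) = p.1)} := by
  exact ⟨fun K C hC => ⟨RadiiDiagram.diameter_le_two_mul_circumradius hC,
    RadiiDiagram.four_mul_inradius_add_le hC, RadiiDiagram.diameter_mul_le hC⟩,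
    RadiiDiagram.unionDiagram_eq, RadiiDiagram.frontier_unionDiagram⟩
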